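/- Let $(\Omega,\mathcal F,\mathbb P)$ be a probability space, $X\in L^2(\Omega)$ and $(X_\ell)_{\ell\ge 0}\subset L^2(\Omega)$ real random variables, $X_{-1}:=0$, $\Delta_\ell X:=X_\ell-X_{\ell-1}$, $V_\ell:=\mathrm{Var}(\Delta_\ell X)$, and let $C_\ell\ge 0$ denote the cost of $\Delta_\ell X$. Assume that there are constants $\alpha,\beta,\gamma,c_\alpha>0$ with $\min(\beta,\gamma)\le 2\alpha$ and constants $K,k_1,k_2>0$ such that for all $\ell\ge 0$ $$|\mathbb E[X-X_\ell]|\le c_\alpha e^{-\alpha\ell},\qquad V_\ell< K e^{-\beta\ell},\qquad k_1e^{\gamma\ell}< C_\ell< k_2e^{\gamma\ell}.$$ For $\varepsilon>0$ put $$L=L(\varepsilon):=\max\Big(\Big\lceil \tfrac{\log(c_\alpha\varepsilon^{-1})}{\alpha}\Big\rceil,1\Big),\qquad M_\ell=M_\ell(\varepsilon):=\max\Big(\Big\lceil \varepsilon^{-2}\sqrt{\tfrac{V_\ell}{C_\ell}}\sum_{k=0}^{L}\sqrt{C_kV_k}\Big\rceil,1\Big),$$ and let the multilevel Monte Carlo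 estimator be $$\mathcal A_{ML}=\mathcal A_{ML}(\varepsilon):=\sum_{\ell=0}^{L}\sum_{i=1}^{M_\ell}\frac{\Delta_\ell X^i}{M_\ell},$$ where the random variables $\Delta_\ell X^i$ ($\ell\ge0$, $i\ge1$) on $\Omega$ are mutually independent and $\Delta_\ell X^i$ has the law of $\Delta_\ell X$. Suppose that $\mathrm{Var}(\mathcal A_{ML}(\varepsilon))>0$ for every $\varepsilon>0$. Let $n(\varepsilon):=\sum_{\ell=0}^{L}M_\ell$, and let $Y_{\varepsilon 1},\dots,Y_{\varepsilon n(\varepsilon)}$ be the random variables $$\frac{\Delta_\ell X^i-\mathbb E[\Delta_\ell X]}{\sqrt{\mathrm{Var}(\mathcal A_{ML})}\,M_\ell},\qquad 0\le\ell\le L,\ 1\le i\le M_\ell,$$ listed level by level, so that $\sum_{m=1}^{n(\varepsilon)}Y_{\varepsilon m}=(\mathcal A_{ML}-\mathbb E[X_L])/\sqrt{\mathrm{Var}(\mathcal A_{ML})}$ is the normalized estimator. Then the extended CLT condition $$\frac{\mathcal A_{ML}-\mathbb E[X_L]}{\sqrt{\mathrm{Var}(\mathcal A_{ML})}}\xrightarrow{\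 d\ }\mathcal N(0,1)\ \text{ as }\varepsilon\downarrow0\qquad\text{and}\qquad \lim_{\varepsilon\downarrow0}\ \max_{1\le m\le n(\varepsilon)}\mathbb E[Y_{\varepsilon m}^2]=0$$ holds if and only if, for every $\nu>0$, $$\lim_{\varepsilon\downarrow0}\ \sum_{\ell=0}^{L}\frac{V_\ell}{\mathrm{Var}(\mathcal A_{ML})\,M_\ell}\,\mathbb E\Big[Z_\ell\,\mathbf 1_{\{Z_\ell>\mathrm{Var}(\mathcal A_{ML})M_\ell^2\nu/V_\ell\}}\Big]=0,\qquad Z_\ell:=\frac{|\Delta_\ell X-\mathbb E[\Delta_\ell X]|^2}{V_\ell},$$ where the summands with $V_\ell=0$ are $0$. -/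

import Mathlib

open MeasureTheory ProbabilityTheory Filter Topology
open scoped ENNReal

noncomputable section

namespace MLMC

variable {Ω : Type*} [MeasurableSpace Ω]

/-- The level differences `Δ_ℓ X = X_ℓ - X_{ℓ-1}`, with the convention `X_{-1} = 0`. -/
def levelDiff (X : ℕ → Ω → ℝ) : ℕ → Ω → ℝ
  | 0 => X 0
  | ℓ + 1 => fun ω => X (ℓ + 1) ω - X ℓ ω

/-- The level variances `V_ℓ = Var(Δ_ℓ X)`. -/
def levelVar (μ : Measure Ω) (X : ℕ → Ω → ℝ) (ℓ : ℕ) : ℝ :=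
  variance (levelDiff X ℓ) μ

/-- `f = O_ℓ(y)`: there is `K > 0` with `|f ℓ| < K |y ℓ|` for every `ℓ ≥ 0`. -/
def LevelBigO (f y : ℕ → ℝ) : Prop :=
  ∃ K : ℝ, 0 < K ∧ ∀ ℓ, |f ℓ| < K * |y ℓ|

/-- `f = Θ_ℓ(y)`: there are `K > k > 0` with `k |y ℓ| < |f ℓ| < K |y ℓ|` for every `ℓ ≥ 0`. -/
def LevelTheta (f y : ℕ → ℝ) : Prop :=
  ∃ k K : ℝ, 0 < k ∧ k < K ∧ ∀ ℓ, k * |y ℓ| < |f ℓ| ∧ |f ℓ| < K * |y ℓ|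

/-- The rate assumption on the target `Xlim`, the approximations `X ℓ` and the costs
`C ℓ = Cost(Δ_ℓ X) ≥ 0`, with rate constants `α, β, γ` and bias constant `cα`. -/
structure RateAssumption (μ : Measure Ω) (Xlim : Ω → ℝ) (X : ℕ → Ω → ℝ) (C : ℕ → ℝ)
    (α β γ cα : ℝ) : Prop where
  alpha_pos : 0 < α
  beta_pos : 0 < β
  gamma_pos : 0 < γ
  bias_const_pos : 0 < cα
  min_le : min β γ ≤ 2 * α
  cost_nonneg : ∀ ℓ, 0 ≤ C ℓ
  bias : ∀ ℓ : ℕ, |∫ ω, (Xlim ω - X ℓ ω) ∂μ| ≤ cα * Real.exp (-α * ℓ)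
  var_rate : LevelBigO (levelVar μ X) (fun ℓ => Real.exp (-β * ℓ))
  cost_rate : LevelTheta C (fun ℓ => Real.exp (γ * ℓ))

/-- `D ℓ i` (`i = 0, 1, 2, …`) are the samples of `Δ_ℓ X`: all samples, over all levels, are
mutually independent, and those of level `ℓ` have the law of `Δ_ℓ X`. -/
structure IsSampling (μ : Measure Ω) (X : ℕ → Ω → ℝ) (D : ℕ → ℕ → Ω → ℝ) : Prop where
  indep : iIndepFun (fun p : ℕ × ℕ => D p.1 p.2) μ
  identDistrib : ∀ ℓ i, IdentDistrib (D ℓ i) (levelDiff X ℓ) μ μ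

/-- The number of levels `L(ε) = max(⌈log(cα / ε) / α⌉, 1)`. -/
def numLevels (α cα ε : ℝ) : ℕ :=
  max ⌈Real.log (cα * ε⁻¹) / α⌉₊ 1

section estimator

variable (μ : Measure Ω) (X : ℕ → Ω → ℝ) (C : ℕ → ℝ) (α cα : ℝ)

/-- The number of samples on level `ℓ`,
`M_ℓ(ε) = max(⌈ε⁻² √(V_ℓ / C_ℓ) ∑_{k ≤ L(ε)} √(C_k V_k)⌉, 1)`. -/
def numSamples (ε : ℝ) (ℓ : ℕ) : ℕ :=
  max ⌈(ε ^ 2)⁻¹ * √(levelVar μ X ℓ / C ℓ) *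
    ∑ k ∈ Finset.range (numLevels α cα ε + 1), √(C k * levelVar μ X k)⌉₊ 1

/-- The total number of samples `n(ε) = ∑_{ℓ ≤ L(ε)} M_ℓ(ε)`. -/
abbrev totalSamples (ε : ℝ) : ℕ :=
  ∑ ℓ : Fin (numLevels α cα ε + 1), numSamples μ X C α cα ε ℓ

variable (D : ℕ → ℕ → Ω → ℝ)

/-- The MLMC estimator. -/
def estimator (ε : ℝ) (ω : Ω) : ℝ :=
  ∑ ℓ ∈ Finset.range (numLevels α cα ε + 1),
    ∑ i ∈ Finset.range (numSamples μ X C α cα ε ℓ), D ℓ i ω / numSamples μ X C α cα ε ℓ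

/-- The variance of the MLMC estimator. -/
def estimatorVar (ε : ℝ) : ℝ :=
  variance (estimator μ X C α cα D ε) μ

/-- The normalized MLMC estimator `(A_ML(ε) - E[X_{L(ε)}]) / √Var(A_ML(ε))`. -/
def normalizedEstimator (ε : ℝ) (ω : Ω) : ℝ :=
  (estimator μ X C α cα D ε ω - ∫ ω', X (numLevels α cα ε) ω' ∂μ) /
    √(estimatorVar μ X C α cα D ε)

/-- The `i`-th sample of level `ℓ`, centred and scaled by `√Var(A_ML(ε)) M_ℓ(ε)`. -/
def scaledSample (ε : ℝ) (ℓ i : ℕ) (ω : Ω) : ℝ :=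
  (D ℓ i ω - ∫ ω', levelDiff X ℓ ω' ∂μ) /
    (√(estimatorVar μ X C α cα D ε) * numSamples μ X C α cα ε ℓ)

/-- The (level, sample number) pair at position `m` when the samples used by the estimator are
listed level by level: the first `M_0` positions are level `0`, the next `M_1` level `1`, and so
on up to level `L(ε)`. -/
def position (ε : ℝ) (m : Fin (totalSamples μ X C α cα ε)) :
    (ℓ : Fin (numLevels α cα ε + 1)) × Fin (numSamples μ X C α cα ε ℓ) :=
  finSigmaFinEquiv.symm m

/-- The triangular array `Y_{ε m}`, `m = 0, …, n(ε) - 1`, of the scaled samples. -/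
def array (ε : ℝ) (m : Fin (totalSamples μ X C α cα ε)) (ω : Ω) : ℝ :=
  scaledSample μ X C α cα D ε (position μ X C α cα ε m).1 (position μ X C α cα ε m).2 ω

/-- The normalized MLMC estimator satisfies the extended CLT condition: it converges in
distribution to `N(0,1)`, and the largest second moment in its triangular array tends to `0`,
both as `ε ↓ 0`. -/
def SatisfiesExtendedCLT [IsProbabilityMeasure μ] : Prop :=
  TendstoInDistribution (fun ε : ℝ => normalizedEstimator μ X C α cα D ε) (𝓝[>] 0)
      (id : ℝ → ℝ) (fun _ => μ) (gaussianReal 0 1) ∧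
    Tendsto (fun ε : ℝ => ⨆ m : Fin (totalSamples μ X C α cα ε),
      ∫ ω, (array μ X C α cα D ε m ω) ^ 2 ∂μ) (𝓝[>] 0) (𝓝 0)

end estimator

/-- The normalized squared fluctuation `Z_ℓ = |Δ_ℓ X - E[Δ_ℓ X]|² / V_ℓ`
(identically `0` if `V_ℓ = 0`). -/
def sqFluct (μ : Measure Ω) (X : ℕ → Ω → ℝ) (ℓ : ℕ) (ω : Ω) : ℝ :=
  |levelDiff X ℓ ω - ∫ ω', levelDiff X ℓ ω' ∂μ| ^ 2 / levelVar μ X ℓ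

/-- The level-wise Lindeberg sum at `ε` with threshold parameter `ν`. -/
def lindebergSum (μ : Measure Ω) (X : ℕ → Ω → ℝ) (C : ℕ → ℝ) (α cα : ℝ)
    (D : ℕ → ℕ → Ω → ℝ) (ν ε : ℝ) : ℝ :=
  ∑ ℓ ∈ Finset.range (numLevels α cα ε + 1),
    levelVar μ X ℓ / (estimatorVar μ X C α cα D ε * numSamples μ X C α cα ε ℓ) *
      ∫ ω, Set.indicator
        {ω' | estimatorVar μ X C α cα D ε * (numSamples μ X C α cα ε ℓ : ℝ) ^ 2 /
          levelVar μ X ℓ * ν < sqFluct μ X ℓ ω'}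
        (sqFluct μ X ℓ) ω ∂μ

end MLMC

end

-- By `normalizedEstimator_eq_sum` the normalized estimator is a sum of independent centred
-- variables whose variances add up to one, so the claim is the Lindeberg–Feller theorem for this
-- array. Samples of one level share a law, so their truncated second moments coincide and
-- Lindeberg's sum collapses to a sum over levels (`lindebergSum_eq`).
--
-- Lindeberg–Feller is proved with characteristic functions `φ_k`. If the largest variance tends to
-- zero, `∏ φ_k` is asymptotically `exp (∑ (φ_k - 1))` (`norm_charFun_sum_sub_exp_le`). Centring and
-- unit total variance make `∑ (φ_k - 1) + t²/2` the sum of the expectations of `exp(itY) - 1 - itY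
-- + (tY)²/2`. Lindeberg's condition makes this small by Taylor's formula
-- (`norm_sum_charFun_sub_one_add_le`). Conversely, the real part has the nonnegative integrand
-- `cos(tY) - 1 + (tY)²/2`, which for one well-chosen `t` dominates `Y²` on `{Y² > ν}`
-- (`sum_truncSq_le`).

namespace LindebergFeller

-- Elementary inequalities for complex exponentials and products.

open Complex in
lemma norm_exp_mul_I_sub_one_sub_le (x : ℝ) :
    ‖exp (x * I) - 1 - x * I‖ ≤ 3 * x ^ 2 := by
  rcases le_or_gt |x| 1 with h | h
  · have h1 : ‖(x * I : ℂ)‖ = |x| := by simp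
    have := norm_exp_sub_one_sub_id_le (x := x * I) (by rw [h1]; exact h)
    rw [h1, sq_abs] at this
    nlinarith [sq_nonneg x]
  · have h1 : ‖exp (x * I) - 1 - x * I‖ ≤ 1 + 1 + |x| := by
      refine (norm_sub_le _ _).trans (add_le_add ((norm_sub_le _ _).trans ?_) (by simp))
      simp [norm_exp_ofReal_mul_I]
    have h2 : x ^ 2 = |x| ^ 2 := (sq_abs x).symm
    nlinarith

-- The cubic bound serves small values of `Y`, the quadratic one the tail, where only second moments
-- are available.
open Complex in
lemma norm_exp_mul_I_taylor_two_le (x : ℝ) :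
    ‖exp (x * I) - 1 - x * I + x ^ 2 / 2‖ ≤ 4 * min (|x| ^ 3) (x ^ 2) := by
  have h2 : x ^ 2 = |x| ^ 2 := (sq_abs x).symm
  have h0 := abs_nonneg x
  rcases le_or_gt |x| 1 with h | h
  · have h1 : ‖(x * I : ℂ)‖ = |x| := by simp
    have key := norm_exp_sub_sum_le_norm_mul_exp (x * I) 3
    have hs : exp (x * I) - ∑ m ∈ Finset.range 3, (x * I) ^ m / (m.factorial : ℂ)
        = exp (x * I) - 1 - x * I + x ^ 2 / 2 := by
      simp [Finset.sum_range_succ, mul_pow]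
      ring
    rw [hs, h1] at key
    have he : Real.exp |x| ≤ 4 :=
      ((Real.exp_le_exp.2 h).trans Real.exp_one_lt_d9.le).trans (by norm_num)
    have hmin : |x| ^ 3 ≤ x ^ 2 := by rw [h2]; exact pow_le_pow_of_le_one h0 h (by norm_num)
    rw [min_eq_left hmin]
    nlinarith [pow_nonneg h0 3]
  · have h1 : ‖exp (x * I) - 1 - x * I + x ^ 2 / 2‖ ≤ 1 + 1 + |x| + x ^ 2 / 2 := by
      refine (norm_add_le _ _).trans (add_le_add ((norm_sub_le _ _).trans
        (add_le_add ((norm_sub_le _ _).trans ?_) (by simp))) ?_)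
      · simp [norm_exp_ofReal_mul_I]
      · simp
    have hmin : x ^ 2 ≤ |x| ^ 3 := by
      rw [h2]; exact pow_le_pow_right₀ h.le (by norm_num)
    rw [min_eq_right hmin]
    nlinarith

-- Near `1` the two terms agree to first order; far from `1` both lie in the unit disc, so their
-- distance is at most `2`. This turns a product of characteristic functions into an exponential of
-- a sum without complex logarithms.
open Complex in
lemma norm_sub_exp_sub_one_le {z : ℂ} (hz : ‖z‖ ≤ 1) :
    ‖z - exp (z - 1)‖ ≤ 2 * ‖z - 1‖ ^ 2 := by
  rcases le_or_gt ‖z - 1‖ 1 with h | h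
  · have := norm_exp_sub_one_sub_id_le h
    rw [norm_sub_rev, show exp (z - 1) - z = exp (z - 1) - 1 - (z - 1) by ring]
    nlinarith [sq_nonneg ‖z - 1‖]
  · have h1 : ‖exp (z - 1)‖ ≤ 1 := by
      rw [norm_exp, Real.exp_le_one_iff, sub_re, one_re, sub_nonpos]
      exact (re_le_norm z).trans hz
    have := norm_sub_le z (exp (z - 1))
    nlinarith

lemma norm_exp_sub_one_le_one {z : ℂ} (hz : ‖z‖ ≤ 1) : ‖Complex.exp (z - 1)‖ ≤ 1 := by
  rw [Complex.norm_exp, Real.exp_le_one_iff, Complex.sub_re, Complex.one_re, sub_nonpos]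
  exact (Complex.re_le_norm z).trans hz

/-- Factors are exchanged one at a time; the remaining ones have norm at most `1`. -/
lemma norm_prod_sub_prod_le {κ : Type*} (s : Finset κ) (a b : κ → ℂ)
    (ha : ∀ k ∈ s, ‖a k‖ ≤ 1) (hb : ∀ k ∈ s, ‖b k‖ ≤ 1) :
    ‖∏ k ∈ s, a k - ∏ k ∈ s, b k‖ ≤ ∑ k ∈ s, ‖a k - b k‖ := by
  classical
  induction s using Finset.induction with
  | empty => simp
  | insert j s hj ih =>
    rw [Finset.prod_insert hj, Finset.prod_insert hj, Finset.sum_insert hj]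
    have ih' := ih (fun k hk => ha k (Finset.mem_insert_of_mem hk))
      (fun k hk => hb k (Finset.mem_insert_of_mem hk))
    have hp : ‖∏ k ∈ s, a k‖ ≤ 1 := by
      rw [norm_prod]
      exact Finset.prod_le_one (fun _ _ => norm_nonneg _)
        (fun k hk => ha k (Finset.mem_insert_of_mem hk))
    calc ‖a j * ∏ k ∈ s, a k - b j * ∏ k ∈ s, b k‖
        = ‖(a j - b j) * ∏ k ∈ s, a k + b j * (∏ k ∈ s, a k - ∏ k ∈ s, b k)‖ := by
          congr 1; ring
      _ ≤ ‖a j - b j‖ * ‖∏ k ∈ s, a k‖ + ‖b j‖ * ‖∏ k ∈ s, a k - ∏ k ∈ s, b k‖ := by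
          rw [← norm_mul, ← norm_mul]; exact norm_add_le _ _
      _ ≤ ‖a j - b j‖ * 1 + 1 * ‖∏ k ∈ s, a k - ∏ k ∈ s, b k‖ := by
          gcongr
          exact hb j (Finset.mem_insert_self _ _)
      _ ≤ _ := by linarith

-- Truncated second moments and normalized rows.

variable {Ω : Type*} [MeasurableSpace Ω] {μ : Measure Ω} {κ ι : Type*}

/-- The truncated second moment `E[Y² ; Y² > ν]`. -/
noncomputable def truncSq (μ : Measure Ω) (Y : Ω → ℝ) (ν : ℝ) : ℝ :=
  ∫ ω, Set.indicator {ω' | ν < Y ω' ^ 2} (fun ω' => Y ω' ^ 2) ω ∂μ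

/-- A finite row of independent centred square integrable random variables whose variances sum
to `1`. -/
structure IsNormalizedRow (μ : Measure Ω) (s : Finset κ) (Y : κ → Ω → ℝ) : Prop where
  indep : iIndepFun Y μ
  memLp : ∀ k, MemLp (Y k) 2 μ
  integral_eq_zero : ∀ k, ∫ ω, Y k ω ∂μ = 0
  sum_integral_sq : ∑ k ∈ s, ∫ ω, Y k ω ^ 2 ∂μ = 1

lemma integrable_indicator_sq {Y : Ω → ℝ} (hY : MemLp Y 2 μ) (ν : ℝ) :
    Integrable (Set.indicator {ω' | ν < Y ω' ^ 2} (fun ω' => Y ω' ^ 2)) μ := by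
  refine hY.integrable_sq.indicator₀ ?_
  exact nullMeasurableSet_lt aemeasurable_const (hY.aestronglyMeasurable.aemeasurable.pow_const 2)

lemma truncSq_nonneg (Y : Ω → ℝ) (ν : ℝ) : 0 ≤ truncSq μ Y ν :=
  integral_nonneg fun _ => Set.indicator_nonneg (fun _ _ => sq_nonneg _) _

lemma charFun_map_eq {Y : Ω → ℝ} (hY : AEMeasurable Y μ) (t : ℝ) :
    charFun (μ.map Y) t = ∫ ω, Complex.exp ((t * Y ω : ℝ) * Complex.I) ∂μ := by
  rw [charFun_apply_real, integral_map hY (by fun_prop)]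
  simp

lemma integrable_sq_div_two {Y : Ω → ℝ} (hY : MemLp Y 2 μ) (t : ℝ) :
    Integrable (fun ω => ((t * Y ω : ℝ) : ℂ) ^ 2 / 2) μ := by
  refine ((hY.integrable_sq.const_mul (t ^ 2 / 2)).ofReal (𝕜 := ℂ)).congr (ae_of_all _ fun ω => ?_)
  simp only [RCLike.ofReal_eq_complex_ofReal]
  push_cast
  ring

namespace IsNormalizedRow

variable {s : Finset κ} {Y : κ → Ω → ℝ}

lemma aemeasurable (h : IsNormalizedRow μ s Y) (k : κ) : AEMeasurable (Y k) μ :=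
  (h.memLp k).aestronglyMeasurable.aemeasurable

lemma sum_charFun_sub_one_add (h : IsNormalizedRow μ s Y) (t : ℝ) :
    ∑ k ∈ s, (charFun (μ.map (Y k)) t - 1) + ((t ^ 2 / 2 : ℝ) : ℂ) =
      ∑ k ∈ s, (charFun (μ.map (Y k)) t - 1 + ((t ^ 2 / 2 * ∫ ω, Y k ω ^ 2 ∂μ : ℝ) : ℂ)) := by
  rw [Finset.sum_add_distrib, ← Complex.ofReal_sum, ← Finset.mul_sum, h.sum_integral_sq, mul_one]

lemma charFun_sum (h : IsNormalizedRow μ s Y) (t : ℝ) :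
    charFun (μ.map (fun ω => ∑ k ∈ s, Y k ω)) t = ∏ k ∈ s, charFun (μ.map (Y k)) t := by
  rw [(h.indep.restrict _).charFun_map_fun_finsetSum_eq_prod (fun k _ => h.aemeasurable k)]
  simp

end IsNormalizedRow

-- Characteristic function estimates for one variable and for one row.

section Probability
variable [IsProbabilityMeasure μ]

lemma integral_sq_le_add_truncSq {Y : Ω → ℝ} (hY : MemLp Y 2 μ) {ν : ℝ} (hν : 0 ≤ ν) :
    ∫ ω, Y ω ^ 2 ∂μ ≤ ν + truncSq μ Y ν := by
  have h := integral_mono (μ := μ) hY.integrable_sq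
    ((integrable_const ν).add (integrable_indicator_sq hY ν)) (fun ω => by
      by_cases h : ν < Y ω ^ 2
      · simp [Set.indicator, h, hν]
      · simp [Set.indicator, h, not_lt.1 h])
  simp only [Pi.add_apply] at h
  rwa [integral_add (integrable_const _) (integrable_indicator_sq hY ν), integral_const,
    probReal_univ, one_smul] at h

lemma integrable_exp_mul_I {Y : Ω → ℝ} (hY : AEMeasurable Y μ) (t : ℝ) :
    Integrable (fun ω => Complex.exp ((t * Y ω : ℝ) * Complex.I)) μ := by
  refine Integrable.of_bound (C := 1) (AEMeasurable.aestronglyMeasurable (by fun_prop)) ?_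
  exact ae_of_all _ fun ω => (Complex.norm_exp_ofReal_mul_I _).le

lemma norm_charFun_map_le_one {Y : Ω → ℝ} (hY : AEMeasurable Y μ) (t : ℝ) :
    ‖charFun (μ.map Y) t‖ ≤ 1 := by
  have := Measure.isProbabilityMeasure_map (μ := μ) hY
  exact norm_charFun_le_one t

lemma integrable_exp_mul_I_sub_one_sub {Y : Ω → ℝ} (hY : MemLp Y 2 μ) (t : ℝ) :
    Integrable (fun ω => Complex.exp ((t * Y ω : ℝ) * Complex.I) - 1
      - (t * Y ω : ℝ) * Complex.I) μ :=
  ((integrable_exp_mul_I hY.aestronglyMeasurable.aemeasurable t).sub (integrable_const _)).sub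
    (((hY.integrable (by norm_num)).const_mul t).ofReal.mul_const _)

lemma integrable_exp_mul_I_taylor_two {Y : Ω → ℝ} (hY : MemLp Y 2 μ) (t : ℝ) :
    Integrable (fun ω => Complex.exp ((t * Y ω : ℝ) * Complex.I) - 1
      - (t * Y ω : ℝ) * Complex.I + ((t * Y ω : ℝ) : ℂ) ^ 2 / 2) μ :=
  (integrable_exp_mul_I_sub_one_sub hY t).add (integrable_sq_div_two hY t)

lemma charFun_sub_one_eq {Y : Ω → ℝ} (hY : MemLp Y 2 μ) (h0 : ∫ ω, Y ω ∂μ = 0) (t : ℝ) :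
    charFun (μ.map Y) t - 1 =
      ∫ ω, (Complex.exp ((t * Y ω : ℝ) * Complex.I) - 1 - (t * Y ω : ℝ) * Complex.I) ∂μ := by
  have hm := hY.aestronglyMeasurable.aemeasurable
  have hi : Integrable (fun ω => ((t * Y ω : ℝ) : ℂ) * Complex.I) μ :=
    ((hY.integrable (by norm_num)).const_mul t).ofReal.mul_const _
  have he : Integrable (fun ω => Complex.exp ((t * Y ω : ℝ) * Complex.I) - 1) μ :=
    (integrable_exp_mul_I hm t).sub (integrable_const _)
  rw [integral_sub he hi, integral_sub (integrable_exp_mul_I hm t) (integrable_const _),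
    charFun_map_eq hm, integral_mul_const, integral_complex_ofReal, integral_const_mul, h0]
  simp

lemma norm_charFun_sub_one_le {Y : Ω → ℝ} (hY : MemLp Y 2 μ) (h0 : ∫ ω, Y ω ∂μ = 0) (t : ℝ) :
    ‖charFun (μ.map Y) t - 1‖ ≤ 3 * t ^ 2 * ∫ ω, Y ω ^ 2 ∂μ := by
  rw [charFun_sub_one_eq hY h0, ← integral_const_mul]
  refine norm_integral_le_of_norm_le (hY.integrable_sq.const_mul _) (ae_of_all _ fun ω => ?_)
  exact (norm_exp_mul_I_sub_one_sub_le _).trans_eq (by ring)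

lemma charFun_sub_one_add_eq {Y : Ω → ℝ} (hY : MemLp Y 2 μ) (h0 : ∫ ω, Y ω ∂μ = 0) (t : ℝ) :
    charFun (μ.map Y) t - 1 + ((t ^ 2 / 2 * ∫ ω, Y ω ^ 2 ∂μ : ℝ) : ℂ) =
      ∫ ω, (Complex.exp ((t * Y ω : ℝ) * Complex.I) - 1 - (t * Y ω : ℝ) * Complex.I
        + ((t * Y ω : ℝ) : ℂ) ^ 2 / 2) ∂μ := by
  rw [integral_add (integrable_exp_mul_I_sub_one_sub hY t) (integrable_sq_div_two hY t),
    ← charFun_sub_one_eq hY h0, ← integral_const_mul, ← integral_complex_ofReal]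
  congr 2
  ext ω
  push_cast
  ring

/-- The expectation is split at `Y² = ν`: below, one factor of `|Y|³` is at most `√ν`; above, the
quadratic bound gives the truncated moment. -/
lemma norm_charFun_sub_one_add_le {Y : Ω → ℝ} (hY : MemLp Y 2 μ) (h0 : ∫ ω, Y ω ∂μ = 0)
    (t ν : ℝ) :
    ‖charFun (μ.map Y) t - 1 + ((t ^ 2 / 2 * ∫ ω, Y ω ^ 2 ∂μ : ℝ) : ℂ)‖ ≤
      4 * |t| ^ 3 * √ν * ∫ ω, Y ω ^ 2 ∂μ + 4 * t ^ 2 * truncSq μ Y ν := by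
  rw [charFun_sub_one_add_eq hY h0, truncSq, ← integral_const_mul, ← integral_const_mul,
    ← integral_add (hY.integrable_sq.const_mul _) ((integrable_indicator_sq hY ν).const_mul _)]
  refine norm_integral_le_of_norm_le ((hY.integrable_sq.const_mul _).add
    ((integrable_indicator_sq hY ν).const_mul _)) (ae_of_all _ fun ω => ?_)
  refine (norm_exp_mul_I_taylor_two_le _).trans ?_
  by_cases h : ν < Y ω ^ 2
  · have : 0 ≤ 4 * |t| ^ 3 * √ν * Y ω ^ 2 := by positivity
    simp only [Set.indicator, Set.mem_ofPred_eq, h, if_true]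
    nlinarith [min_le_right (|t * Y ω| ^ 3) ((t * Y ω) ^ 2)]
  · simp only [Set.indicator, Set.mem_ofPred_eq, h, if_false, mul_zero, add_zero]
    have h1 : |Y ω| ≤ √ν := Real.abs_le_sqrt (not_lt.1 h)
    have h2 : |t * Y ω| ^ 3 = |t| ^ 3 * (|Y ω| * Y ω ^ 2) := by
      rw [abs_mul, mul_pow, ← sq_abs (Y ω)]; ring
    calc 4 * min (|t * Y ω| ^ 3) ((t * Y ω) ^ 2) ≤ 4 * |t * Y ω| ^ 3 := by
          gcongr; exact min_le_left _ _
      _ = 4 * (|t| ^ 3 * (|Y ω| * Y ω ^ 2)) := by rw [h2]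
      _ ≤ 4 * (|t| ^ 3 * (√ν * Y ω ^ 2)) := by gcongr
      _ = _ := by ring

/-- The integrand `cos(tY) - 1 + (tY)²/2` is nonnegative. On `{Y² > ν}` the cosine part costs at
most `2`, and the choice of `t` gives `(tY)²/2 = Y² + 2Y²/ν ≥ Y² + 2`. -/
lemma truncSq_le_re_charFun {Y : Ω → ℝ} (hY : MemLp Y 2 μ) (h0 : ∫ ω, Y ω ∂μ = 0)
    {t ν : ℝ} (hν : 0 < ν) (ht : t ^ 2 = 2 + 4 / ν) :
    truncSq μ Y ν ≤
      (charFun (μ.map Y) t - 1 + ((t ^ 2 / 2 * ∫ ω, Y ω ^ 2 ∂μ : ℝ) : ℂ)).re := by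
  have hint := integrable_exp_mul_I_taylor_two hY t
  have hre : ∀ ω, (Complex.exp ((t * Y ω : ℝ) * Complex.I) - 1 - (t * Y ω : ℝ) * Complex.I
        + ((t * Y ω : ℝ) : ℂ) ^ 2 / 2).re = Real.cos (t * Y ω) - 1 + (t * Y ω) ^ 2 / 2 := by
    intro ω
    rw [show ((t * Y ω : ℝ) : ℂ) ^ 2 / 2 = (((t * Y ω) ^ 2 / 2 : ℝ) : ℂ) by push_cast; ring,
      Complex.add_re, Complex.sub_re, Complex.sub_re, Complex.exp_ofReal_mul_I_re,
      Complex.ofReal_re, Complex.re_ofReal_mul]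
    simp
  rw [charFun_sub_one_add_eq hY h0, ← RCLike.re_eq_complex_re, ← integral_re hint]
  refine integral_mono (integrable_indicator_sq hY ν) hint.re fun ω => ?_
  change _ ≤ (Complex.exp ((t * Y ω : ℝ) * Complex.I) - 1 - (t * Y ω : ℝ) * Complex.I
        + ((t * Y ω : ℝ) : ℂ) ^ 2 / 2).re
  rw [hre]
  by_cases h : ν < Y ω ^ 2
  · simp only [Set.indicator, Set.mem_ofPred_eq, h, if_true]
    have h1 : 1 ≤ Y ω ^ 2 / ν := (one_le_div hν).2 h.le
    have h2 : (t * Y ω) ^ 2 / 2 = Y ω ^ 2 + 2 * (Y ω ^ 2 / ν) := by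
      rw [mul_pow, ht]; ring
    linarith [Real.neg_one_le_cos (t * Y ω)]
  · simp only [Set.indicator, Set.mem_ofPred_eq, h, if_false]
    linarith [Real.one_sub_sq_div_two_le_cos (x := t * Y ω)]

namespace IsNormalizedRow

variable {s : Finset κ} {Y : κ → Ω → ℝ}

lemma norm_charFun_sum_sub_exp_le (h : IsNormalizedRow μ s Y) (t : ℝ) {m : ℝ}
    (hm : ∀ k ∈ s, ∫ ω, Y k ω ^ 2 ∂μ ≤ m) :
    ‖charFun (μ.map (fun ω => ∑ k ∈ s, Y k ω)) t
      - Complex.exp (∑ k ∈ s, (charFun (μ.map (Y k)) t - 1))‖ ≤ 18 * t ^ 4 * m := by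
  rw [h.charFun_sum, Complex.exp_sum]
  have h1 : ∀ k, ‖charFun (μ.map (Y k)) t‖ ≤ 1 := fun k =>
    norm_charFun_map_le_one (h.aemeasurable k) t
  refine (norm_prod_sub_prod_le s _ _ (fun k _ => h1 k)
    (fun k _ => norm_exp_sub_one_le_one (h1 k))).trans ?_
  calc ∑ k ∈ s, ‖charFun (μ.map (Y k)) t - Complex.exp (charFun (μ.map (Y k)) t - 1)‖
      ≤ ∑ k ∈ s, 18 * t ^ 4 * m * ∫ ω, Y k ω ^ 2 ∂μ := by
        refine Finset.sum_le_sum fun k hk => ?_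
        have h0 : 0 ≤ ∫ ω, Y k ω ^ 2 ∂μ := integral_nonneg fun _ => sq_nonneg _
        calc _ ≤ 2 * ‖charFun (μ.map (Y k)) t - 1‖ ^ 2 := norm_sub_exp_sub_one_le (h1 k)
          _ ≤ 2 * (3 * t ^ 2 * ∫ ω, Y k ω ^ 2 ∂μ) ^ 2 := by
            gcongr
            exact norm_charFun_sub_one_le (h.memLp k) (h.integral_eq_zero k) t
          _ = 18 * t ^ 4 * (∫ ω, Y k ω ^ 2 ∂μ) * ∫ ω, Y k ω ^ 2 ∂μ := by ring
          _ ≤ _ := by gcongr; exact hm k hk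
    _ = _ := by rw [← Finset.mul_sum, h.sum_integral_sq, mul_one]

lemma norm_sum_charFun_sub_one_add_le (h : IsNormalizedRow μ s Y) (t ν : ℝ) :
    ‖∑ k ∈ s, (charFun (μ.map (Y k)) t - 1) + ((t ^ 2 / 2 : ℝ) : ℂ)‖ ≤
      4 * |t| ^ 3 * √ν + 4 * t ^ 2 * ∑ k ∈ s, truncSq μ (Y k) ν := by
  rw [h.sum_charFun_sub_one_add]
  refine (norm_sum_le_of_le s fun k _ =>
    norm_charFun_sub_one_add_le (h.memLp k) (h.integral_eq_zero k) t ν).trans_eq ?_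
  rw [Finset.sum_add_distrib, ← Finset.mul_sum, ← Finset.mul_sum, h.sum_integral_sq, mul_one]

lemma sum_truncSq_le (h : IsNormalizedRow μ s Y) {t ν : ℝ} (hν : 0 < ν)
    (ht : t ^ 2 = 2 + 4 / ν) :
    ∑ k ∈ s, truncSq μ (Y k) ν ≤
      (∑ k ∈ s, (charFun (μ.map (Y k)) t - 1)).re + t ^ 2 / 2 := by
  have h1 := congrArg Complex.re (h.sum_charFun_sub_one_add t)
  rw [Complex.add_re, Complex.ofReal_re] at h1
  rw [h1, Complex.re_sum]
  exact Finset.sum_le_sum fun k _ =>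
    truncSq_le_re_charFun (h.memLp k) (h.integral_eq_zero k) hν ht

/-- This is how Lindeberg's condition forces the largest variance to vanish. -/
lemma integral_sq_le (h : IsNormalizedRow μ s Y) {ν : ℝ} (hν : 0 ≤ ν) {k : κ} (hk : k ∈ s) :
    ∫ ω, Y k ω ^ 2 ∂μ ≤ ν + ∑ j ∈ s, truncSq μ (Y j) ν :=
  (integral_sq_le_add_truncSq (h.memLp k) hν).trans (by
    gcongr
    exact Finset.single_le_sum (f := fun j => truncSq μ (Y j) ν)
      (fun j _ => truncSq_nonneg _ _) hk)

end IsNormalizedRow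

-- The limit theorem for triangular arrays.

variable {l : Filter ι} {s : ι → Finset κ} {Y : ι → κ → Ω → ℝ}

lemma tendsto_charFun_sum_sub_exp (hrow : ∀ᶠ i in l, IsNormalizedRow μ (s i) (Y i))
    (hmax : ∀ m : ℝ, 0 < m → ∀ᶠ i in l, ∀ k ∈ s i, ∫ ω, Y i k ω ^ 2 ∂μ ≤ m) (t : ℝ) :
    Tendsto (fun i => charFun (μ.map (fun ω => ∑ k ∈ s i, Y i k ω)) t
      - Complex.exp (∑ k ∈ s i, (charFun (μ.map (Y i k)) t - 1))) l (𝓝 0) := by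
  rw [Metric.tendsto_nhds]
  intro e he
  have hpos : 0 < e / (18 * t ^ 4 + 1) := by positivity
  filter_upwards [hrow, hmax _ hpos] with i hi hm
  rw [dist_zero_right]
  refine (hi.norm_charFun_sum_sub_exp_le t hm).trans_lt ?_
  rw [mul_div_assoc', div_lt_iff₀ (by positivity)]
  nlinarith

/-- **Lindeberg–Feller theorem**, in terms of characteristic functions. -/
theorem tendsto_charFun_and_max_iff_lindeberg
    (hrow : ∀ᶠ i in l, IsNormalizedRow μ (s i) (Y i)) :
    ((∀ t : ℝ, Tendsto (fun i => charFun (μ.map (fun ω => ∑ k ∈ s i, Y i k ω)) t) l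
        (𝓝 (Complex.exp ((-(t ^ 2 / 2) : ℝ) : ℂ)))) ∧
      ∀ m : ℝ, 0 < m → ∀ᶠ i in l, ∀ k ∈ s i, ∫ ω, Y i k ω ^ 2 ∂μ ≤ m) ↔
    ∀ ν : ℝ, 0 < ν → Tendsto (fun i => ∑ k ∈ s i, truncSq μ (Y i k) ν) l (𝓝 0) := by
  constructor
  · rintro ⟨hc, hmax⟩ ν hν
    set t := √(2 + 4 / ν) with htdef
    have ht : t ^ 2 = 2 + 4 / ν := Real.sq_sqrt (by positivity)
    have h1 := (hc t).sub (tendsto_charFun_sum_sub_exp hrow hmax t)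
    simp only [sub_sub_cancel, sub_zero] at h1
    -- The modulus of the exponential sees only the real part of its exponent, so a real logarithm
    -- recovers the limit of that part.
    have h2 := h1.norm
    simp only [Complex.norm_exp, Complex.ofReal_re] at h2
    have h3 := ((Real.continuousAt_log (Real.exp_ne_zero (-(t ^ 2 / 2)))).tendsto.comp h2)
    simp only [Function.comp_def, Real.log_exp] at h3
    have h4 := h3.add_const (t ^ 2 / 2)
    rw [neg_add_cancel] at h4
    refine tendsto_of_tendsto_of_tendsto_of_le_of_le' tendsto_const_nhds h4
      (Eventually.of_forall fun i => Finset.sum_nonneg fun k _ => truncSq_nonneg _ _) ?_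
    filter_upwards [hrow] with i hi using hi.sum_truncSq_le hν ht
  · intro hL
    have hmax : ∀ m : ℝ, 0 < m → ∀ᶠ i in l, ∀ k ∈ s i, ∫ ω, Y i k ω ^ 2 ∂μ ≤ m := by
      intro m hm
      filter_upwards [hrow, (hL (m / 2) (half_pos hm)).eventually_lt_const (half_pos hm)]
        with i hi hlt k hk
      linarith [hi.integral_sq_le (half_pos hm).le hk]
    refine ⟨fun t => ?_, hmax⟩
    have h1 : Tendsto (fun i => ∑ k ∈ s i, (charFun (μ.map (Y i k)) t - 1)
        + ((t ^ 2 / 2 : ℝ) : ℂ)) l (𝓝 0) := by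
      rw [Metric.tendsto_nhds]
      intro e he
      -- The truncation level is fixed first, to control the cubic term; only then does the limit
      -- remove the tail term. The `+ 1` in the denominators covers `t = 0`.
      obtain ⟨ν, hν, hνe⟩ : ∃ ν : ℝ, 0 < ν ∧ 4 * |t| ^ 3 * √ν ≤ e / 2 := by
        refine ⟨(e / (2 * (4 * |t| ^ 3 + 1))) ^ 2, by positivity, ?_⟩
        rw [Real.sqrt_sq (by positivity), mul_div_assoc', div_le_div_iff₀ (by positivity)
          (by positivity)]
        nlinarith
      have hp : 0 < e / (2 * (4 * t ^ 2 + 1)) := by positivity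
      filter_upwards [hrow, (hL ν hν).eventually_lt_const hp] with i hi hlt
      rw [dist_zero_right]
      refine (hi.norm_sum_charFun_sub_one_add_le t ν).trans_lt ?_
      have h2 : 4 * t ^ 2 * ∑ k ∈ s i, truncSq μ (Y i k) ν
          ≤ 4 * t ^ 2 * (e / (2 * (4 * t ^ 2 + 1))) := by gcongr
      have h3 : 4 * t ^ 2 * (e / (2 * (4 * t ^ 2 + 1))) < e / 2 := by
        rw [mul_div_assoc', div_lt_div_iff₀ (by positivity) (by positivity)]
        nlinarith
      linarith
    have h2 := h1.sub_const ((t ^ 2 / 2 : ℝ) : ℂ)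
    simp only [add_sub_cancel_right, zero_sub] at h2
    have h3 := (Complex.continuous_exp.tendsto _).comp h2
    have h4 := (tendsto_charFun_sum_sub_exp hrow hmax t).add h3
    simp only [Function.comp_def, sub_add_cancel, zero_add] at h4
    rwa [Complex.ofReal_neg]

end Probability

/-- Lévy's continuity theorem for sequences suffices, since convergence along a countably generated
filter such as `𝓝[>] 0` can be tested on sequences. -/
lemma tendsto_probabilityMeasure_iff_charFun {l : Filter ι} [l.IsCountablyGenerated]
    {P : ι → ProbabilityMeasure ℝ} {Q : ProbabilityMeasure ℝ} :
    Tendsto P l (𝓝 Q) ↔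
      ∀ t : ℝ, Tendsto (fun i => charFun (P i : Measure ℝ) t) l
        (𝓝 (charFun (Q : Measure ℝ) t)) := by
  refine ⟨fun h t => ?_, fun h => tendsto_of_seq_tendsto fun u hu => ?_⟩
  · refine tendsto_of_seq_tendsto fun u hu => ?_
    exact ProbabilityMeasure.tendsto_iff_tendsto_charFun.1 (h.comp hu) t
  · exact ProbabilityMeasure.tendsto_iff_tendsto_charFun.2 fun t => (h t).comp hu

lemma tendstoInDistribution_gaussian_iff [IsProbabilityMeasure μ] {l : Filter ι}
    [l.IsCountablyGenerated] {S : ι → Ω → ℝ} (hS : ∀ i, AEMeasurable (S i) μ) :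
    TendstoInDistribution S l (id : ℝ → ℝ) (fun _ => μ) (gaussianReal 0 1) ↔
      ∀ t : ℝ, Tendsto (fun i => charFun (μ.map (S i)) t) l
        (𝓝 (Complex.exp ((-(t ^ 2 / 2) : ℝ) : ℂ))) := by
  have hg : ∀ t : ℝ, charFun ((gaussianReal 0 1).map (id : ℝ → ℝ)) t =
      Complex.exp ((-(t ^ 2 / 2) : ℝ) : ℂ) := by
    intro t
    rw [Measure.map_id, charFun_gaussianReal]
    congr 1
    push_cast
    simp
  constructor
  · intro h t
    rw [← hg]
    exact tendsto_probabilityMeasure_iff_charFun.1 h.tendsto t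
  · intro h
    refine ⟨hS, by fun_prop, tendsto_probabilityMeasure_iff_charFun.2 fun t => ?_⟩
    change Tendsto _ _ (𝓝 (charFun ((gaussianReal 0 1).map (id : ℝ → ℝ)) t))
    rw [hg]
    exact h t

end LindebergFeller

-- The multilevel estimator as the sum of a normalized row.

namespace MLMC

open LindebergFeller

variable {Ω : Type*} [MeasurableSpace Ω] {μ : Measure Ω} {X : ℕ → Ω → ℝ} {C : ℕ → ℝ} {α cα : ℝ}
  {D : ℕ → ℕ → Ω → ℝ}

lemma memLp_levelDiff (hX : ∀ ℓ, MemLp (X ℓ) 2 μ) : ∀ ℓ, MemLp (levelDiff X ℓ) 2 μ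
  | 0 => hX 0
  | ℓ + 1 => (hX (ℓ + 1)).sub (hX ℓ)

/-- Telescoping identifies the centring `E[X_L]` with the sum of the level means. -/
lemma sum_integral_levelDiff (hX : ∀ ℓ, Integrable (X ℓ) μ) (n : ℕ) :
    ∑ ℓ ∈ Finset.range (n + 1), ∫ ω, levelDiff X ℓ ω ∂μ = ∫ ω, X n ω ∂μ := by
  induction n with
  | zero => simp [levelDiff]
  | succ n ih =>
    rw [Finset.sum_range_succ, ih]
    simp only [levelDiff]
    rw [integral_sub (hX _) (hX _)]
    ring

lemma levelVar_nonneg (ℓ : ℕ) : 0 ≤ levelVar μ X ℓ := variance_nonneg _ _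

lemma numSamples_pos (ε : ℝ) (ℓ : ℕ) : 0 < (numSamples μ X C α cα ε ℓ : ℝ) :=
  Nat.cast_pos.2 (lt_of_lt_of_le one_pos (le_max_right _ _))

/-- The (level, sample number) pairs used by the estimator. -/
noncomputable def sampleIndices (μ : Measure Ω) (X : ℕ → Ω → ℝ) (C : ℕ → ℝ) (α cα ε : ℝ) :
    Finset ((_ : ℕ) × ℕ) :=
  (Finset.range (numLevels α cα ε + 1)).sigma fun ℓ => Finset.range (numSamples μ X C α cα ε ℓ)

lemma estimator_eq_sum (ε : ℝ) :
    estimator μ X C α cα D ε = ∑ k ∈ sampleIndices μ X C α cα ε,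
      fun ω => (numSamples μ X C α cα ε k.1 : ℝ)⁻¹ * D k.1 k.2 ω := by
  ext ω
  rw [Finset.sum_apply, sampleIndices, Finset.sum_sigma, estimator]
  simp only [div_eq_inv_mul]

lemma normalizedEstimator_eq_sum (hX : ∀ ℓ, Integrable (X ℓ) μ) (ε : ℝ) (ω : Ω) :
    normalizedEstimator μ X C α cα D ε ω = ∑ k ∈ sampleIndices μ X C α cα ε,
      scaledSample μ X C α cα D ε k.1 k.2 ω := by
  rw [sampleIndices, Finset.sum_sigma, normalizedEstimator, estimator,
    ← sum_integral_levelDiff hX, ← Finset.sum_sub_distrib, Finset.sum_div]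
  refine Finset.sum_congr rfl fun ℓ _ => ?_
  have hM := (numSamples_pos (μ := μ) (X := X) (C := C) (α := α) (cα := cα) ε ℓ).ne'
  simp only [scaledSample]
  rw [← Finset.sum_div, ← Finset.sum_div, Finset.sum_sub_distrib, Finset.sum_const,
    Finset.card_range, nsmul_eq_mul, mul_comm √_, ← div_div,
    sub_div _ (_ * _ : ℝ), mul_div_cancel_left₀ _ hM, sub_div]

lemma IsSampling.memLp (hD : IsSampling μ X D) (hX : ∀ ℓ, MemLp (X ℓ) 2 μ) (ℓ i : ℕ) :
    MemLp (D ℓ i) 2 μ :=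
  (hD.identDistrib ℓ i).memLp_iff.2 (memLp_levelDiff hX ℓ)

lemma IsSampling.estimatorVar_eq [IsProbabilityMeasure μ] (hD : IsSampling μ X D)
    (hX : ∀ ℓ, MemLp (X ℓ) 2 μ) (ε : ℝ) :
    estimatorVar μ X C α cα D ε = ∑ k ∈ sampleIndices μ X C α cα ε,
      levelVar μ X k.1 / (numSamples μ X C α cα ε k.1 : ℝ) ^ 2 := by
  rw [estimatorVar, estimator_eq_sum, IndepFun.variance_sum]
  · refine Finset.sum_congr rfl fun k _ => ?_
    rw [variance_const_mul, (hD.identDistrib k.1 k.2).variance_eq, levelVar]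
    ring
  · exact fun k _ => (hD.memLp hX k.1 k.2).const_mul _
  · intro k _ j _ hkj
    have hne : (k.1, k.2) ≠ (j.1, j.2) := fun h => hkj (by
      rw [Prod.mk.injEq] at h; exact Sigma.ext h.1 (heq_of_eq h.2))
    exact (hD.indep.indepFun hne).comp (φ := fun x => _ * x) (ψ := fun x => _ * x)
      (measurable_const_mul _) (measurable_const_mul _)

lemma IsSampling.integral_scaledSample_sq (hD : IsSampling μ X D) (ε : ℝ) (ℓ i : ℕ) :
    ∫ ω, scaledSample μ X C α cα D ε ℓ i ω ^ 2 ∂μ =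
      levelVar μ X ℓ / (numSamples μ X C α cα ε ℓ : ℝ) ^ 2 / estimatorVar μ X C α cα D ε := by
  simp only [scaledSample, div_pow, mul_pow]
  rw [integral_div, ← (hD.identDistrib ℓ i).integral_eq,
    ← variance_eq_integral (hD.identDistrib ℓ i).aemeasurable_fst,
    (hD.identDistrib ℓ i).variance_eq, Real.sq_sqrt (by exact variance_nonneg _ _), div_div,
    mul_comm (estimatorVar _ _ _ _ _ _ _), levelVar]

lemma IsSampling.isNormalizedRow [IsProbabilityMeasure μ] (hD : IsSampling μ X D)
    (hX : ∀ ℓ, MemLp (X ℓ) 2 μ) {ε : ℝ}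
    (hvar : 0 < estimatorVar μ X C α cα D ε) :
    IsNormalizedRow μ (sampleIndices μ X C α cα ε)
      (fun k => scaledSample μ X C α cα D ε k.1 k.2) where
  indep := by
    have hinj : Function.Injective (fun k : (_ : ℕ) × ℕ => (k.1, k.2)) := fun k j h => by
      rw [Prod.mk.injEq] at h; exact Sigma.ext h.1 (heq_of_eq h.2)
    exact (hD.indep.precomp hinj).comp
      (fun k x => (x - ∫ ω', levelDiff X k.1 ω' ∂μ) /
        (√(estimatorVar μ X C α cα D ε) * numSamples μ X C α cα ε k.1))
      (fun k => by fun_prop)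
  memLp k := by
    have h := ((hD.memLp hX k.1 k.2).sub (memLp_const (∫ ω', levelDiff X k.1 ω' ∂μ))).mul_const
      (√(estimatorVar μ X C α cα D ε) * numSamples μ X C α cα ε k.1)⁻¹
    exact h
  integral_eq_zero k := by
    simp only [scaledSample]
    rw [integral_div, integral_sub ((hD.memLp hX k.1 k.2).integrable (by norm_num))
      (integrable_const _), (hD.identDistrib k.1 k.2).integral_eq]
    simp
  sum_integral_sq := by
    simp only [hD.integral_scaledSample_sq]
    rw [← Finset.sum_div, ← hD.estimatorVar_eq hX, div_self hvar.ne']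

lemma IsSampling.truncSq_scaledSample [IsProbabilityMeasure μ] (hD : IsSampling μ X D)
    (hX : ∀ ℓ, MemLp (X ℓ) 2 μ)
    {ε : ℝ} (hvar : 0 < estimatorVar μ X C α cα D ε) (ν : ℝ) (ℓ i : ℕ) :
    truncSq μ (scaledSample μ X C α cα D ε ℓ i) ν =
      levelVar μ X ℓ / (estimatorVar μ X C α cα D ε * (numSamples μ X C α cα ε ℓ : ℝ) ^ 2) *
      ∫ ω, Set.indicator
        {ω' | estimatorVar μ X C α cα D ε * (numSamples μ X C α cα ε ℓ : ℝ) ^ 2 /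
          levelVar μ X ℓ * ν < sqFluct μ X ℓ ω'}
        (sqFluct μ X ℓ) ω ∂μ := by
  rcases (levelVar_nonneg (μ := μ) (X := X) ℓ).eq_or_lt with hV | hV
  -- On a degenerate level the right side vanishes through its prefactor, the left because the whole
  -- second moment is zero.
  · rw [← hV, zero_div, zero_mul]
    have h0 := hD.integral_scaledSample_sq (C := C) (α := α) (cα := cα) ε ℓ i
    rw [← hV, zero_div, zero_div] at h0
    refine le_antisymm ?_ (truncSq_nonneg _ _)
    rw [← h0]
    have hY := (hD.isNormalizedRow hX hvar).memLp ⟨ℓ, i⟩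
    exact integral_mono (integrable_indicator_sq hY ν) hY.integrable_sq
      fun ω => Set.indicator_le_self' (fun _ _ => sq_nonneg _) ω
  · have hM := numSamples_pos (μ := μ) (X := X) (C := C) (α := α) (cα := cα) ε ℓ
    set W := estimatorVar μ X C α cα D ε
    set M := (numSamples μ X C α cα ε ℓ : ℝ)
    set e := ∫ ω', levelDiff X ℓ ω' ∂μ
    -- The truncated square is a measurable function of the sample, so its expectation depends only
    -- on the law of `levelDiff X ℓ`. There `Y² = V/(W M²) · Z`, which also converts the threshold
    -- `ν`.
    have hmeas : Measurable (fun x : ℝ => Set.indicator {y : ℝ | ν < ((y - e) / (√W * M)) ^ 2}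
        (fun y => ((y - e) / (√W * M)) ^ 2) x) := by
      refine Measurable.indicator (by fun_prop) ?_
      exact measurableSet_lt measurable_const (by fun_prop)
    have h1 := ((hD.identDistrib ℓ i).comp hmeas).integral_eq
    rw [← integral_const_mul]
    refine Eq.trans ?_ (h1.trans ?_)
    · rfl
    · refine integral_congr_ae (ae_of_all _ fun ω => ?_)
      have hWM : 0 < W * M ^ 2 := by positivity
      have hsq : ((levelDiff X ℓ ω - e) / (√W * M)) ^ 2 =
          levelVar μ X ℓ / (W * M ^ 2) * sqFluct μ X ℓ ω := by
        rw [sqFluct, sq_abs, div_pow, mul_pow, Real.sq_sqrt hvar.le]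
        change _ = _ * ((levelDiff X ℓ ω - e) ^ 2 / levelVar μ X ℓ)
        field_simp
      have hiff : ν < ((levelDiff X ℓ ω - e) / (√W * M)) ^ 2 ↔
          W * M ^ 2 / levelVar μ X ℓ * ν < sqFluct μ X ℓ ω := by
        rw [hsq, div_mul_eq_mul_div, lt_div_iff₀ hWM, div_mul_eq_mul_div, div_lt_iff₀ hV,
          mul_comm ν, mul_comm (levelVar μ X ℓ)]
      simp only [Function.comp_apply, Set.indicator, Set.mem_ofPred_eq, hiff, mul_ite, mul_zero]
      simp only [hsq]

/-- The `M_ℓ` equal terms of a level turn the factor `1 / M_ℓ²` into `1 / M_ℓ`. -/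
lemma IsSampling.lindebergSum_eq [IsProbabilityMeasure μ] (hD : IsSampling μ X D)
    (hX : ∀ ℓ, MemLp (X ℓ) 2 μ)
    {ε : ℝ} (hvar : 0 < estimatorVar μ X C α cα D ε) (ν : ℝ) :
    lindebergSum μ X C α cα D ν ε = ∑ k ∈ sampleIndices μ X C α cα ε,
      truncSq μ (scaledSample μ X C α cα D ε k.1 k.2) ν := by
  rw [sampleIndices, Finset.sum_sigma, lindebergSum]
  refine Finset.sum_congr rfl fun ℓ _ => ?_
  simp only [hD.truncSq_scaledSample hX hvar]
  rw [Finset.sum_const, Finset.card_range, nsmul_eq_mul, ← mul_assoc]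
  have hM := (numSamples_pos (μ := μ) (X := X) (C := C) (α := α) (cα := cα) ε ℓ).ne'
  congr 1
  field_simp

lemma forall_array_iff {ε : ℝ} {p : ℝ → Prop} :
    (∀ m, p (∫ ω, array μ X C α cα D ε m ω ^ 2 ∂μ)) ↔
      ∀ k ∈ sampleIndices μ X C α cα ε,
        p (∫ ω, scaledSample μ X C α cα D ε k.1 k.2 ω ^ 2 ∂μ) := by
  constructor
  · intro h k hk
    simp only [sampleIndices, Finset.mem_sigma, Finset.mem_range] at hk
    have hpos : position μ X C α cα ε (finSigmaFinEquiv ⟨⟨k.1, hk.1⟩, ⟨k.2, hk.2⟩⟩) =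
        ⟨⟨k.1, hk.1⟩, ⟨k.2, hk.2⟩⟩ := Equiv.symm_apply_apply _ _
    have := h (finSigmaFinEquiv ⟨⟨k.1, hk.1⟩, ⟨k.2, hk.2⟩⟩)
    unfold array at this
    rwa [hpos] at this
  · intro h m
    refine h ⟨(position μ X C α cα ε m).1, (position μ X C α cα ε m).2⟩ ?_
    simp only [sampleIndices, Finset.mem_sigma, Finset.mem_range]
    exact ⟨(position μ X C α cα ε m).1.2, (position μ X C α cα ε m).2.2⟩

lemma tendsto_iSup_array_iff {l : Filter ℝ} :
    Tendsto (fun ε : ℝ => ⨆ m : Fin (totalSamples μ X C α cα ε),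
      ∫ ω, (array μ X C α cα D ε m ω) ^ 2 ∂μ) l (𝓝 0) ↔
    ∀ a : ℝ, 0 < a → ∀ᶠ ε in l, ∀ k ∈ sampleIndices μ X C α cα ε,
      ∫ ω, scaledSample μ X C α cα D ε k.1 k.2 ω ^ 2 ∂μ ≤ a := by
  have hnn : ∀ ε m, 0 ≤ ∫ ω, (array μ X C α cα D ε m ω) ^ 2 ∂μ := fun ε m =>
    integral_nonneg fun _ => sq_nonneg _
  constructor
  · intro h a ha
    filter_upwards [h.eventually_lt_const ha] with ε hε
    refine forall_array_iff (p := fun x => x ≤ a) |>.1 fun m => ?_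
    exact (le_ciSup (Set.finite_range _).bddAbove m).trans hε.le
  · intro h
    rw [Metric.tendsto_nhds]
    intro a ha
    -- Termwise bounds give only a weak inequality for the supremum; halving restores strictness.
    filter_upwards [h (a / 2) (half_pos ha)] with ε hε
    rw [Real.dist_eq, sub_zero, abs_of_nonneg (Real.iSup_nonneg (hnn ε))]
    exact (Real.iSup_le (forall_array_iff (p := fun x => x ≤ a / 2) |>.2 hε)
      (half_pos ha).le).trans_lt (half_lt_self ha)

lemma IsSampling.aemeasurable_normalizedEstimator (hD : IsSampling μ X D) (ε : ℝ) :
    AEMeasurable (normalizedEstimator μ X C α cα D ε) μ := by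
  have hm : ∀ ℓ i, AEMeasurable (D ℓ i) μ := fun ℓ i => (hD.identDistrib ℓ i).aemeasurable_fst
  refine AEMeasurable.div_const (AEMeasurable.sub_const ?_ _) _
  exact Finset.aemeasurable_fun_sum _ fun ℓ _ => Finset.aemeasurable_fun_sum _ fun i _ =>
    (hm ℓ i).div_const _

end MLMC

theorem corollary1 {Ω : Type*} [MeasurableSpace Ω] (μ : Measure Ω) [IsProbabilityMeasure μ]
    (Xlim : Ω → ℝ) (X : ℕ → Ω → ℝ) (C : ℕ → ℝ) (α β γ cα : ℝ) (D : ℕ → ℕ → Ω → ℝ)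
    (hXlim : MemLp Xlim 2 μ) (hX : ∀ ℓ, MemLp (X ℓ) 2 μ)
    (hrate : MLMC.RateAssumption μ Xlim X C α β γ cα)
    (hD : MLMC.IsSampling μ X D)
    (hvar : ∀ ε : ℝ, 0 < ε → 0 < MLMC.estimatorVar μ X C α cα D ε) :
    MLMC.SatisfiesExtendedCLT μ X C α cα D ↔
      ∀ ν : ℝ, 0 < ν →
        Tendsto (fun ε : ℝ => MLMC.lindebergSum μ X C α cα D ν ε) (𝓝[>] 0) (𝓝 0) := by
  have hpos : ∀ᶠ ε : ℝ in 𝓝[>] 0, 0 < ε := eventually_mem_nhdsWithin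
  have hrow := hpos.mono fun ε hε => hD.isNormalizedRow hX (hvar ε hε)
  have hint : ∀ ℓ, Integrable (X ℓ) μ := fun ℓ => (hX ℓ).integrable (by norm_num)
  have hsum : ∀ ε, MLMC.normalizedEstimator μ X C α cα D ε = fun ω =>
      ∑ k ∈ MLMC.sampleIndices μ X C α cα ε, MLMC.scaledSample μ X C α cα D ε k.1 k.2 ω :=
    fun ε => funext fun ω => MLMC.normalizedEstimator_eq_sum hint ε ω
  rw [MLMC.SatisfiesExtendedCLT, LindebergFeller.tendstoInDistribution_gaussian_iff
    hD.aemeasurable_normalizedEstimator, MLMC.tendsto_iSup_array_iff]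
  simp only [hsum]
  rw [LindebergFeller.tendsto_charFun_and_max_iff_lindeberg hrow]
  refine forall₂_congr fun ν _ => tendsto_congr' ?_
  -- The two Lindeberg sums are identified using the positive variance available for `ε > 0`, which
  -- suffices for the one-sided limit.
  filter_upwards [hpos] with ε hε
  exact (hD.lindebergSum_eq hX (hvar ε hε) ν).symm
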